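/- Let $\mathcal H=\mathbb C^2\otimes\mathbb C^2\otimes\mathbb C^2$ be the Hilbert space of three qubits $A,B,C$, and let $\mathcal U\subset\mathcal H$ be the set of the following five (unnormalized, mutually orthogonal) vectors, written in the order $ABC$ unless indicated otherwise: $$|0\rangle(|00\rangle-2|10\rangle+|11\rangle),\quad (|01\rangle+2|00\rangle-3|10\rangle)|0\rangle,\quad |1\rangle(|01\rangle+|10\rangle),\quad (|00\rangle+|11\rangle)|1\rangle,$$ $$(|0\rangle+|1\rangle)_B\,(|00\rangle+|01\rangle+|10\rangle-|11\rangle)_{CA}.$$ Let $\mathcal U^\perp$ be the orthogonal complement of $\operatorname{span}(\mathcal U)$. For a bipartition $X|Y$ of $\{A,B,C\}$ into two non-empty parts, a state (density operator) $\rho$ on $\mathcal H$ is called one-copy distillable (1-distillable) across $X|Y$ if there is a vector $|\psi\rangle\in\mathcal H$ of Schmidt rank two with respect to $X|Y$ such that $\langle\psi|\rho^{T_X}|\psi\rangle<0$, where $T_X$ denotes partial transposition on $X$. Then, for every bipartition $X|Y$ of $\{A,B,C\}$ into two non-empty parts: (i) every state $\rho$ whose range is contained in $\mathcal U^\perp$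 is one-copy distillable across $X|Y$; (ii) for every non-zero orthogonal projector $P$ whose range is contained in $\mathcal U^\perp$, the marginals $P_X=\operatorname{Tr}_Y P$ and $P_Y=\operatorname{Tr}_X P$ satisfy $\operatorname{rank}(P)<\max\{\operatorname{rank}(P_X),\operatorname{rank}(P_Y)\}$. -/

import Mathlib

open scoped ComplexOrder

/-- Three-qubit computational basis labels: the parties `A`, `B`, `C` are `0`, `1`, `2`. -/
abbrev Bits : Type := Fin 3 → Fin 2

/-- The three-qubit Hilbert space `ℂ² ⊗ ℂ² ⊗ ℂ²`, with its computational basis. -/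
abbrev ThreeQubit : Type := EuclideanSpace ℂ Bits

/-- The computational basis vector `|a b c⟩` (parties in the order `A`, `B`, `C`). -/
noncomputable def ket (a b c : Fin 2) : ThreeQubit :=
  EuclideanSpace.single (![a, b, c] : Bits) (1 : ℂ)

/-- `|0⟩(|00⟩ - 2|10⟩ + |11⟩)`. -/
noncomputable def phi0 : ThreeQubit :=
  ket 0 0 0 - (2 : ℂ) • ket 0 1 0 + ket 0 1 1

/-- `(|01⟩ + 2|00⟩ - 3|10⟩)|0⟩`. -/
noncomputable def phi1 : ThreeQubit :=
  ket 0 1 0 + (2 : ℂ) • ket 0 0 0 - (3 : ℂ) • ket 1 0 0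

/-- `|1⟩(|01⟩ + |10⟩)`. -/
noncomputable def psi0 : ThreeQubit :=
  ket 1 0 1 + ket 1 1 0

/-- `(|00⟩ + |11⟩)|1⟩`. -/
noncomputable def psi1 : ThreeQubit :=
  ket 0 0 1 + ket 1 1 1

/-- `(|0⟩ + |1⟩)_B (|00⟩ + |01⟩ + |10⟩ - |11⟩)_{CA}`, expanded in the order `A`, `B`, `C`. -/
noncomputable def kappa : ThreeQubit :=
  ∑ b : Fin 2, (ket 0 b 0 + ket 1 b 0 + ket 0 b 1 - ket 1 b 1)

/-- The five-element set `𝒰`. -/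
noncomputable def setU : Set ThreeQubit :=
  {phi0, phi1, psi0, psi1, kappa}

/-- The orthogonal complement of the span of `𝒰`. -/
noncomputable def complU : Submodule ℂ ThreeQubit :=
  (Submodule.span ℂ setU)ᗮ

section Operators

variable {ι X Y : Type*} [Fintype ι] [DecidableEq ι] [Fintype X] [Fintype Y]

/-- Density matrices. -/
def IsState (ρ : Matrix ι ι ℂ) : Prop :=
  ρ.PosSemidef ∧ ρ.trace = 1

/-- The operator `M` is supported on (has range contained in) the subspace `V`.
For Hermitian `M` this is the usual notion of support. -/
def SupportedOn (M : Matrix ι ι ℂ) (V : Submodule ℂ (EuclideanSpace ℂ ι)) : Prop :=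
  LinearMap.range (Matrix.toEuclideanLin M) ≤ V

/-- Partial transpose, on the first factor, of an operator on `ℂ^X ⊗ ℂ^Y`. -/
def partialTranspose (M : Matrix (X × Y) (X × Y) ℂ) : Matrix (X × Y) (X × Y) ℂ :=
  Matrix.of fun p q => M (q.1, p.2) (p.1, q.2)

/-- The marginal on the first factor (trace over the second factor). -/
def marginalFst (M : Matrix (X × Y) (X × Y) ℂ) : Matrix X X ℂ :=
  Matrix.of fun x x' => ∑ y, M (x, y) (x', y)

/-- The marginal on the second factor (trace over the first factor). -/
def marginalSnd (M : Matrix (X × Y) (X × Y) ℂ) : Matrix Y Y ℂ :=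
  Matrix.of fun y y' => ∑ x, M (x, y) (x, y')

/-- The Schmidt rank of a bipartite vector: the rank of its coefficient matrix. -/
noncomputable def schmidtRank (ψ : X × Y → ℂ) : ℕ :=
  (Matrix.of fun x y => ψ (x, y)).rank

/-- A bipartite operator `ρ` is one-copy distillable (1-distillable) if `⟨ψ| ρ^Γ |ψ⟩ < 0` for
some vector `ψ` of Schmidt rank two, where `ρ^Γ` is the partial transpose of `ρ`. -/
def OneCopyDistillable (ρ : Matrix (X × Y) (X × Y) ℂ) : Prop :=
  ∃ ψ : X × Y → ℂ, schmidtRank ψ = 2 ∧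
    (dotProduct (star ψ) (Matrix.mulVec (partialTranspose ρ) ψ)).re < 0

end Operators

/-- A three-qubit operator, regarded as an operator on the tensor product of the joint system of
the parties in `S` with the joint system of the remaining parties. -/
def bipartite (S : Finset (Fin 3)) (M : Matrix Bits Bits ℂ) :
    Matrix (({i // i ∈ S} → Fin 2) × ({i // i ∉ S} → Fin 2))
      (({i // i ∈ S} → Fin 2) × ({i // i ∉ S} → Fin 2)) ℂ :=
  let e := Equiv.piEquivPiSubtypeProd (fun i => i ∈ S) (fun _ => Fin 2)
  Matrix.reindex e e M

/-! Every cut of three qubits isolates one qubit, and `complU` contains no nonzero product vector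
across any such cut: the five linear equations and the 2 × 2 minors have only the zero solution
(`productFreeRange_bipartite`). Both claims then follow for any nonzero `M ≥ 0` on ℂ² ⊗ ℂ^Y with
product-free range.

Rank (`rank_lt_rank_marginalSnd`): the two slices map the range of `M` into the range of its
marginal on `Y`. If the rank did not drop, one slice would be invertible, and an eigenvector of its
inverse composed with the other slice would be a product vector.

Distillability (`oneCopyDistillable_of_productFreeRange`): on ℂ² ⊗ ℂ^Y, failure of 1-distillability
means a positive partial transpose. Product-freeness then puts the kernel of one diagonal block
inside the kernel of the marginal, so the marginal has rank at most that of `M`, a contradiction. -/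

/-- The product vector `a ⊗ b`. -/
def productVec {X Y : Type*} (a : X → ℂ) (b : Y → ℂ) : X × Y → ℂ :=
  fun p => a p.1 * b p.2

/-- The range of `M` contains no nonzero product vector. -/
def ProductFreeRange {X Y : Type*} [Fintype X] [Fintype Y]
    (M : Matrix (X × Y) (X × Y) ℂ) : Prop :=
  ∀ a b, productVec a b ∈ LinearMap.range M.mulVecLin → productVec a b = 0

/-- The diagonal block `⟨x| M |x⟩` of an operator on `ℂ^X ⊗ ℂ^Y`. -/
def diagBlock {X Y : Type*} (M : Matrix (X × Y) (X × Y) ℂ) (x : X) : Matrix Y Y ℂ :=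
  M.submatrix (Prod.mk x) (Prod.mk x)

theorem Matrix.IsHermitian.mem_range_mulVecLin {n : Type*} [Fintype n] [DecidableEq n]
    {N : Matrix n n ℂ} (hN : N.IsHermitian) {v : n → ℂ}
    (hv : ∀ z, N.mulVec z = 0 → dotProduct (star z) v = 0) :
    v ∈ LinearMap.range N.mulVecLin := by
  have hsym : (Matrix.toEuclideanLin N).IsSymmetric := Matrix.isSymmetric_toEuclideanLin_iff.2 hN
  have hmem : WithLp.toLp 2 v ∈ (LinearMap.range (Matrix.toEuclideanLin N)) := by
    rw [← Submodule.orthogonal_orthogonal (LinearMap.range (Matrix.toEuclideanLin N)),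
      hsym.orthogonal_range, Submodule.mem_orthogonal]
    intro u hu
    have := hv u.ofLp (by simpa using congrArg WithLp.ofLp hu)
    rw [EuclideanSpace.inner_eq_star_dotProduct, dotProduct_comm]
    exact this
  obtain ⟨u, hu⟩ := hmem
  exact ⟨u.ofLp, by simpa using congrArg WithLp.ofLp hu⟩

theorem marginalSnd_eq_sum {X Y : Type*} [Fintype X] (M : Matrix (X × Y) (X × Y) ℂ) :
    marginalSnd M = ∑ x, diagBlock M x := by
  ext y y'
  simp [marginalSnd, diagBlock, Matrix.sum_apply]

theorem Matrix.PosSemidef.diagBlock {X Y : Type*} {M : Matrix (X × Y) (X × Y) ℂ} (hM : M.PosSemidef) (x : X) :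
    (diagBlock M x).PosSemidef :=
  hM.submatrix _

theorem partialTranspose_isHermitian {X Y : Type*} {M : Matrix (X × Y) (X × Y) ℂ} (hM : M.IsHermitian) :
    (partialTranspose M).IsHermitian := by
  ext p q
  exact hM.apply _ _

theorem Matrix.PosSemidef.marginalSnd {X Y : Type*} [Fintype X]
    {M : Matrix (X × Y) (X × Y) ℂ} (hM : M.PosSemidef) :
    (marginalSnd M).PosSemidef := by
  rw [marginalSnd_eq_sum]
  exact Matrix.posSemidef_sum _ fun x _ => hM.diagBlock x

/-! ### Positive operators on ℂ² ⊗ ℂ^Y with product-free range -/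

section Bipartite

variable {X Y : Type*} [Fintype X] [Fintype Y]

theorem mulVec_productVec_single [DecidableEq X] (M : Matrix (X × Y) (X × Y) ℂ) (x : X)
    (z : Y → ℂ) (p : X × Y) :
    M.mulVec (productVec (Pi.single x 1) z) p = ∑ y, M p (x, y) * z y := by
  simp only [Matrix.mulVec, dotProduct, productVec, Fintype.sum_prod_type]
  rw [Finset.sum_eq_single x]
  · simp
  · intro x' _ hx'
    simp [hx']
  · simp

theorem dotProduct_productVec_single [DecidableEq X] (x : X) (z : Y → ℂ) (w : X × Y → ℂ) :
    dotProduct (star (productVec (Pi.single x 1) z)) w =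
      dotProduct (star z) (fun y => w (x, y)) := by
  simp only [dotProduct, productVec, Fintype.sum_prod_type, Pi.star_apply]
  rw [Finset.sum_eq_single x]
  · simp
  · intro x' _ hx'
    simp [hx']
  · simp

theorem quadForm_productVec_single [DecidableEq X] (M : Matrix (X × Y) (X × Y) ℂ) (x : X)
    (z : Y → ℂ) :
    dotProduct (star (productVec (Pi.single x 1) z)) (M.mulVec (productVec (Pi.single x 1) z)) =
      dotProduct (star z) ((diagBlock M x).mulVec z) := by
  rw [dotProduct_productVec_single]
  congr 1
  funext y
  rw [mulVec_productVec_single]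
  rfl

theorem mulVec_productVec_single_eq_zero [DecidableEq X] {M : Matrix (X × Y) (X × Y) ℂ}
    (hM : M.PosSemidef) {x : X} {z : Y → ℂ} (hz : (diagBlock M x).mulVec z = 0) :
    M.mulVec (productVec (Pi.single x 1) z) = 0 := by
  rw [← hM.dotProduct_mulVec_zero_iff, quadForm_productVec_single, hz, dotProduct_zero]

/-- The nonnegative quadratic forms of the blocks sum to that of the marginal, so all vanish with
it. -/
theorem diagBlock_mulVec_eq_zero {M : Matrix (X × Y) (X × Y) ℂ} (hM : M.PosSemidef)
    {z : Y → ℂ} (hz : (marginalSnd M).mulVec z = 0) (x : X) : (diagBlock M x).mulVec z = 0 := by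
  rw [← (hM.diagBlock x).dotProduct_mulVec_zero_iff]
  have hsum : ∑ x, dotProduct (star z) ((diagBlock M x).mulVec z) = 0 := by
    rw [← dotProduct_sum, ← Matrix.sum_mulVec, ← marginalSnd_eq_sum, hz, dotProduct_zero]
  exact (Finset.sum_eq_zero_iff_of_nonneg
    fun x _ => (hM.diagBlock x).dotProduct_mulVec_nonneg z).1 hsum x (Finset.mem_univ x)

/-- If `z` is in the kernel of the marginal, then `e_x ⊗ z` is in the kernel of `M`, hence
orthogonal to its range; so every slice is orthogonal to `z`. -/
theorem slice_mem_range_marginalSnd {M : Matrix (X × Y) (X × Y) ℂ} (hM : M.PosSemidef)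
    {w : X × Y → ℂ} (hw : w ∈ LinearMap.range M.mulVecLin) (x : X) :
    (fun y => w (x, y)) ∈ LinearMap.range (marginalSnd M).mulVecLin := by
  classical
  obtain ⟨u, rfl⟩ := hw
  refine hM.marginalSnd.isHermitian.mem_range_mulVecLin fun z hz => ?_
  have h0 := mulVec_productVec_single_eq_zero hM (diagBlock_mulVec_eq_zero hM hz x)
  rw [← dotProduct_productVec_single, Matrix.mulVecLin_apply, Matrix.dotProduct_mulVec,
    ← hM.isHermitian.eq, ← Matrix.star_mulVec, h0, star_zero, zero_dotProduct]

/-- A nonzero positive operator on `ℂ² ⊗ ℂ^Y` without product vectors in its range has smaller rank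
than its marginal on `ℂ^Y`: a space of dimension at least `d` in `ℂ² ⊗ ℂ^d` contains a product
vector. -/
theorem rank_lt_rank_marginalSnd {M : Matrix (X × Y) (X × Y) ℂ} {x₀ x₁ : X}
    (hne : x₀ ≠ x₁) (hX : ∀ x, x = x₀ ∨ x = x₁) (hM : M.PosSemidef) (h0 : M ≠ 0)
    (hfree : ProductFreeRange M) : M.rank < (marginalSnd M).rank := by
  classical
  by_contra! hle
  let W := LinearMap.range M.mulVecLin
  let V := LinearMap.range (marginalSnd M).mulVecLin
  let f : X → W →ₗ[ℂ] V := fun x =>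
    LinearMap.codRestrict V (LinearMap.funLeft ℂ ℂ (Prod.mk x) ∘ₗ W.subtype)
      fun w => slice_mem_range_marginalSnd hM w.2 x
  -- Proportional slices make `w` the product of `(1, μ)` with its slice at `x₀`.
  have hker : ∀ (μ : ℂ) (w : W), f x₁ w = μ • f x₀ w → w = 0 := by
    intro μ w hw
    have hval : ∀ y, w.1 (x₁, y) = μ * w.1 (x₀, y) := fun y =>
      congrFun (congrArg Subtype.val hw) y
    have hprod : productVec (fun x => if x = x₀ then 1 else μ) (fun y => w.1 (x₀, y)) = w.1 := by
      funext ⟨x, y⟩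
      rcases hX x with rfl | rfl
      · simp [productVec]
      · simp [productVec, hne.symm, hval]
    exact Subtype.ext (hprod.symm.trans (hfree _ _ (hprod.symm ▸ w.2 :)))
  have hinj : Function.Injective (f x₀) := by
    rw [injective_iff_map_eq_zero]
    intro w hw
    have hval : ∀ y, w.1 (x₀, y) = 0 := fun y => congrFun (congrArg Subtype.val hw) y
    have hprod : productVec (Pi.single x₁ 1) (fun y => w.1 (x₁, y)) = w.1 := by
      funext ⟨x, y⟩
      rcases hX x with rfl | rfl
      · simp [productVec, hne, hval]
      · simp [productVec]
    exact Subtype.ext (hprod.symm.trans (hfree _ _ (hprod.symm ▸ w.2 :)))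
  have hdim : Module.finrank ℂ W = Module.finrank ℂ V :=
    le_antisymm (LinearMap.finrank_le_finrank_of_injective hinj) hle
  let e := LinearEquiv.ofInjectiveOfFinrankEq (f x₀) hinj hdim
  have hWnt : Nontrivial W := by
    rw [Submodule.nontrivial_iff_ne_bot]
    intro hW
    apply h0
    have : M.mulVecLin = 0 := LinearMap.range_eq_bot.1 hW
    ext i j
    simpa using congrFun (LinearMap.congr_fun this (Pi.single j 1)) i
  -- An eigenvector of `(f x₀)⁻¹ ∘ f x₁` has proportional slices.
  obtain ⟨μ, hμ⟩ := Module.End.exists_eigenvalue (e.symm.toLinearMap ∘ₗ f x₁)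
  obtain ⟨w, hw⟩ := hμ.exists_hasEigenvector
  refine hw.2 (hker μ w ?_)
  have := congrArg e hw.apply_eq_smul
  rw [map_smul] at this
  exact (e.apply_symm_apply (f x₁ w)).symm.trans this

theorem quadForm_partialTranspose_productVec (M : Matrix (X × Y) (X × Y) ℂ) (a : X → ℂ)
    (b : Y → ℂ) :
    dotProduct (star (productVec a b)) ((partialTranspose M).mulVec (productVec a b)) =
      dotProduct (star (productVec (star a) b)) (M.mulVec (productVec (star a) b)) := by
  simp only [dotProduct, Matrix.mulVec, productVec, partialTranspose, Fintype.sum_prod_type,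
    Finset.mul_sum, Matrix.of_apply, Pi.star_apply, star_mul', star_star]
  calc _ = ∑ x, ∑ x', ∑ y, ∑ y', star (a x) * star (b y) * (M (x', y) (x, y') * (a x' * b y')) :=
        Finset.sum_congr rfl fun _ _ => Finset.sum_comm
    _ = ∑ x', ∑ x, ∑ y, ∑ y', star (a x) * star (b y) * (M (x', y) (x, y') * (a x' * b y')) :=
        Finset.sum_comm
    _ = ∑ x', ∑ y, ∑ x, ∑ y', star (a x) * star (b y) * (M (x', y) (x, y') * (a x' * b y')) :=
        Finset.sum_congr rfl fun _ _ => Finset.sum_comm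
    _ = _ := by
      refine Finset.sum_congr rfl fun _ _ => Finset.sum_congr rfl fun _ _ =>
        Finset.sum_congr rfl fun _ _ => Finset.sum_congr rfl fun _ _ => ?_
      ring

theorem exists_eq_productVec_of_schmidtRank_le_one {ψ : X × Y → ℂ} (h : schmidtRank ψ ≤ 1) :
    ∃ a b, ψ = productVec a b := by
  rw [schmidtRank, Matrix.rank_eq_finrank_span_cols,
    Submodule.finrank_le_one_iff_isPrincipal] at h
  obtain ⟨g, hg⟩ := h.principal
  have hcol : ∀ y, ∃ c : ℂ, c • g = fun x => ψ (x, y) := fun y =>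
    Submodule.mem_span_singleton.1 (hg ▸ Submodule.subset_span ⟨y, rfl⟩)
  choose c hc using hcol
  refine ⟨g, c, funext fun ⟨x, y⟩ => ?_⟩
  rw [productVec, mul_comm]
  exact (congrFun (hc y) x).symm

/-- The Schmidt rank is at most `card X = 2`. On product vectors, partial transposition only
conjugates the first factor, so the form stays nonnegative. -/
theorem partialTranspose_posSemidef_of_not_oneCopyDistillable
    {M : Matrix (X × Y) (X × Y) ℂ} (hX : Fintype.card X = 2) (hM : M.PosSemidef)
    (h : ¬ OneCopyDistillable M) : (partialTranspose M).PosSemidef := by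
  have hH := partialTranspose_isHermitian hM.isHermitian
  refine Matrix.PosSemidef.of_dotProduct_mulVec_nonneg hH fun ψ => ?_
  rcases Nat.lt_or_ge (schmidtRank ψ) 2 with hlt | hge
  · obtain ⟨a, b, rfl⟩ := exists_eq_productVec_of_schmidtRank_le_one (Nat.le_of_lt_succ hlt)
    rw [quadForm_partialTranspose_productVec]
    exact hM.dotProduct_mulVec_nonneg _
  · have h2 : schmidtRank ψ = 2 := le_antisymm ((Matrix.rank_le_card_height _).trans hX.le) hge
    rw [Complex.nonneg_iff]
    refine ⟨not_lt.1 fun hneg => h ⟨ψ, h2, hneg⟩, ?_⟩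
    exact (hH.im_star_dotProduct_mulVec_self ψ).symm

/-- A nonzero positive operator on `ℂ² ⊗ ℂ^Y` without product vectors in its range has a negative
partial transpose. -/
theorem oneCopyDistillable_of_productFreeRange {M : Matrix (X × Y) (X × Y) ℂ} {x₀ x₁ : X}
    (hne : x₀ ≠ x₁) (hX : ∀ x, x = x₀ ∨ x = x₁) (hM : M.PosSemidef) (h0 : M ≠ 0)
    (hfree : ProductFreeRange M) : OneCopyDistillable M := by
  classical
  by_contra hnot
  have hcard : Fintype.card X = 2 := by
    rw [← Finset.card_univ, ← Finset.card_pair hne]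
    congr 1
    ext x
    simpa using hX x
  have hT := partialTranspose_posSemidef_of_not_oneCopyDistillable hcard hM hnot
  -- The partial transpose has the same diagonal blocks, so it kills `e_{x₀} ⊗ z`. Its `x₁`
  -- component is the off-diagonal block `⟨x₀|M|x₁⟩` applied to `z`, so `M (e_{x₁} ⊗ z)` is a
  -- product vector.
  have hker : LinearMap.ker (diagBlock M x₀).mulVecLin ≤
      LinearMap.ker (marginalSnd M).mulVecLin := by
    intro z hz
    have hz : (diagBlock M x₀).mulVec z = 0 := hz
    have hTz := mulVec_productVec_single_eq_zero (x := x₀) hT (z := z) hz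
    have hprod : productVec (Pi.single x₁ 1) ((diagBlock M x₁).mulVec z) =
        M.mulVec (productVec (Pi.single x₁ 1) z) := by
      funext ⟨x, y⟩
      rcases hX x with rfl | rfl
      · have := congrFun hTz (x₁, y)
        rw [mulVec_productVec_single] at this
        rw [mulVec_productVec_single]
        simpa [productVec, hne, partialTranspose] using this.symm
      · rw [mulVec_productVec_single]
        simp [productVec, diagBlock, Matrix.mulVec, dotProduct]
    have hzero := hfree _ _ ⟨_, hprod.symm⟩
    have hz₁ : (diagBlock M x₁).mulVec z = 0 := by
      funext y
      simpa [productVec] using congrFun hzero (x₁, y)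
    rw [LinearMap.mem_ker, Matrix.mulVecLin_apply, marginalSnd_eq_sum, Matrix.sum_mulVec]
    refine Finset.sum_eq_zero fun x _ => ?_
    rcases hX x with rfl | rfl
    exacts [hz, hz₁]
  have h1 := LinearMap.finrank_range_add_finrank_ker (diagBlock M x₀).mulVecLin
  have h2 := LinearMap.finrank_range_add_finrank_ker (marginalSnd M).mulVecLin
  have h3 := Submodule.finrank_mono hker
  have h4 : (diagBlock M x₀).rank ≤ M.rank := Matrix.rank_submatrix_le M _ _
  have h5 := rank_lt_rank_marginalSnd hne hX hM h0 hfree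
  unfold Matrix.rank at h4 h5
  omega

end Bipartite

/-! ### Absence of product vectors in `complU` -/

theorem complU_equations {v : ThreeQubit} (hv : v ∈ complU) :
    v ![0, 0, 0] - 2 * v ![0, 1, 0] + v ![0, 1, 1] = 0 ∧
    v ![0, 1, 0] + 2 * v ![0, 0, 0] - 3 * v ![1, 0, 0] = 0 ∧
    v ![1, 0, 1] + v ![1, 1, 0] = 0 ∧
    v ![0, 0, 1] + v ![1, 1, 1] = 0 ∧
    (v ![0, 0, 0] + v ![1, 0, 0] + v ![0, 0, 1] - v ![1, 0, 1]) +
      (v ![0, 1, 0] + v ![1, 1, 0] + v ![0, 1, 1] - v ![1, 1, 1]) = 0 := by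
  have key : ∀ u ∈ setU, inner ℂ u v = 0 := fun u hu =>
    (Submodule.mem_orthogonal _ _).1 hv u (Submodule.subset_span hu)
  simpa [mul_comm _ (2 : ℂ), mul_comm _ (3 : ℂ), add_sub_add_comm, setU, phi0, phi1, psi0, psi1, kappa, ket, inner_add_left, inner_sub_left,
    inner_smul_left, EuclideanSpace.inner_single_left, Fin.sum_univ_two] using key

/-- The equations of `complU` and the `2 × 2` minors across the cut of party `A` have only the
zero solution. -/
theorem eq_zero_of_minors_fst {v0 v1 v2 v3 v4 v5 v6 v7 : ℂ}
    (h1 : v0 - 2 * v2 + v3 = 0) (h2 : v2 + 2 * v0 - 3 * v4 = 0) (h3 : v5 + v6 = 0)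
    (h4 : v1 + v7 = 0) (h5 : (v0 + v4 + v1 - v5) + (v2 + v6 + v3 - v7) = 0)
    (m1 : v0 * v5 = v4 * v1) (m2 : v0 * v6 = v4 * v2) (m3 : v0 * v7 = v4 * v3)
    (m4 : v1 * v6 = v5 * v2) (m5 : v1 * v7 = v5 * v3) (m6 : v2 * v7 = v6 * v3) :
    v0 = 0 ∧ v1 = 0 ∧ v2 = 0 ∧ v3 = 0 ∧ v4 = 0 ∧ v5 = 0 ∧ v6 = 0 ∧ v7 = 0 := by
  grind

/-- The equations of `complU` and the `2 × 2` minors across the cut of party `B` have only the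
zero solution. -/
theorem eq_zero_of_minors_snd {v0 v1 v2 v3 v4 v5 v6 v7 : ℂ}
    (h1 : v0 - 2 * v2 + v3 = 0) (h2 : v2 + 2 * v0 - 3 * v4 = 0) (h3 : v5 + v6 = 0)
    (h4 : v1 + v7 = 0) (h5 : (v0 + v4 + v1 - v5) + (v2 + v6 + v3 - v7) = 0)
    (m1 : v0 * v3 = v2 * v1) (m2 : v0 * v6 = v2 * v4) (m3 : v0 * v7 = v2 * v5)
    (m4 : v1 * v6 = v3 * v4) (m5 : v1 * v7 = v3 * v5) (m6 : v4 * v7 = v6 * v5) :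
    v0 = 0 ∧ v1 = 0 ∧ v2 = 0 ∧ v3 = 0 ∧ v4 = 0 ∧ v5 = 0 ∧ v6 = 0 ∧ v7 = 0 := by
  grind

/-- The equations of `complU` and the `2 × 2` minors across the cut of party `C` have only the
zero solution. -/
theorem eq_zero_of_minors_thd {v0 v1 v2 v3 v4 v5 v6 v7 : ℂ}
    (h1 : v0 - 2 * v2 + v3 = 0) (h2 : v2 + 2 * v0 - 3 * v4 = 0) (h3 : v5 + v6 = 0)
    (h4 : v1 + v7 = 0) (h5 : (v0 + v4 + v1 - v5) + (v2 + v6 + v3 - v7) = 0)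
    (m1 : v0 * v3 = v1 * v2) (m2 : v0 * v5 = v1 * v4) (m3 : v0 * v7 = v1 * v6)
    (m4 : v2 * v5 = v3 * v4) (m5 : v2 * v7 = v3 * v6) (m6 : v4 * v7 = v5 * v6) :
    v0 = 0 ∧ v1 = 0 ∧ v2 = 0 ∧ v3 = 0 ∧ v4 = 0 ∧ v5 = 0 ∧ v6 = 0 ∧ v7 = 0 := by
  grind

/-- `complU` contains no nonzero vector which is a product across one party and the other two. -/
theorem eq_zero_of_mem_complU_of_exchange {v : ThreeQubit} (hv : v ∈ complU) (i : Fin 3)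
    (h : ∀ f g : Bits, v f * v g =
      v (Function.update f i (g i)) * v (Function.update g i (f i))) : v = 0 := by
  obtain ⟨h1, h2, h3, h4, h5⟩ := complU_equations hv
  -- Exchanging the `i`-th bits of two labels expresses the 2 × 2 minors across cut `i`, uniformly
  -- in `i`.
  have hb : ∀ a b c a' b' c' : Fin 2, v ![a, b, c] * v ![a', b', c'] =
      v (Function.update ![a, b, c] i (![a', b', c'] i)) *
        v (Function.update ![a', b', c'] i (![a, b, c] i)) := fun a b c a' b' c' => h _ _
  have upd0 : ∀ a b c a' : Fin 2, Function.update ![a, b, c] 0 a' = ![a', b, c] := by decide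
  have upd1 : ∀ a b c a' : Fin 2, Function.update ![a, b, c] 1 a' = ![a, a', c] := by decide
  have upd2 : ∀ a b c a' : Fin 2, Function.update ![a, b, c] 2 a' = ![a, b, a'] := by decide
  suffices hz : v ![0, 0, 0] = 0 ∧ v ![0, 0, 1] = 0 ∧ v ![0, 1, 0] = 0 ∧ v ![0, 1, 1] = 0 ∧
      v ![1, 0, 0] = 0 ∧ v ![1, 0, 1] = 0 ∧ v ![1, 1, 0] = 0 ∧ v ![1, 1, 1] = 0 by
    have hf : ∀ f : Bits, f = ![f 0, f 1, f 2] := by decide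
    ext f
    rw [hf f]
    generalize f 0 = a, f 1 = b, f 2 = c
    obtain ⟨z1, z2, z3, z4, z5, z6, z7, z8⟩ := hz
    fin_cases a <;> fin_cases b <;> fin_cases c <;> simpa
  fin_cases i
  · have hm : ∀ b c b' c' : Fin 2, v ![0, b, c] * v ![1, b', c'] =
        v ![1, b, c] * v ![0, b', c'] := fun b c b' c' => by
      simpa [upd0] using hb 0 b c 1 b' c'
    exact eq_zero_of_minors_fst h1 h2 h3 h4 h5 (hm 0 0 0 1) (hm 0 0 1 0) (hm 0 0 1 1)
      (hm 0 1 1 0) (hm 0 1 1 1) (hm 1 0 1 1)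
  · have hm : ∀ b c b' c' : Fin 2, v ![b, 0, c] * v ![b', 1, c'] =
        v ![b, 1, c] * v ![b', 0, c'] := fun b c b' c' => by
      simpa [upd1] using hb b 0 c b' 1 c'
    exact eq_zero_of_minors_snd h1 h2 h3 h4 h5 (hm 0 0 0 1) (hm 0 0 1 0) (hm 0 0 1 1)
      (hm 0 1 1 0) (hm 0 1 1 1) (hm 1 0 1 1)
  · have hm : ∀ b c b' c' : Fin 2, v ![b, c, 0] * v ![b', c', 1] =
        v ![b, c, 1] * v ![b', c', 0] := fun b c b' c' => by
      simpa [upd2] using hb b c 0 b' c' 1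
    exact eq_zero_of_minors_thd h1 h2 h3 h4 h5 (hm 0 0 0 1) (hm 0 0 1 0) (hm 0 0 1 1)
      (hm 0 1 1 0) (hm 0 1 1 1) (hm 1 0 1 1)

/-! ### Exchange of the factors and reduction to a single party -/

theorem OneCopyDistillable.of_swap {X Y : Type*} [Fintype X] [Fintype Y]
    {M : Matrix (X × Y) (X × Y) ℂ}
    (h : OneCopyDistillable (M.submatrix Prod.swap Prod.swap)) : OneCopyDistillable M := by
  obtain ⟨ψ, hrank, hneg⟩ := h
  -- The partial transposes on `X` and on `Y` differ by a full transpose, which conjugating the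
  -- vector absorbs.
  refine ⟨fun p => star (ψ p.swap), ?_, ?_⟩
  · have : (Matrix.of fun x y => star (ψ (y, x))) =
        (Matrix.of fun y x => ψ (y, x)).conjTranspose := rfl
    rw [← hrank, schmidtRank, schmidtRank]
    exact (congrArg Matrix.rank this).trans (Matrix.rank_conjTranspose _)
  · convert hneg using 2
    simp only [dotProduct, Matrix.mulVec, Finset.mul_sum]
    rw [Finset.sum_comm]
    refine Fintype.sum_equiv (Equiv.prodComm X Y) _ _ fun p =>
      Fintype.sum_equiv (Equiv.prodComm X Y) _ _ fun q => ?_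
    simp only [Pi.star_apply, star_star, partialTranspose, Matrix.of_apply, Matrix.submatrix_apply,
      Equiv.prodComm_apply, Prod.swap]
    ring

theorem ProductFreeRange.swap {X Y : Type*} [Fintype X] [Fintype Y]
    {M : Matrix (X × Y) (X × Y) ℂ} (h : ProductFreeRange M) :
    ProductFreeRange (M.submatrix (Prod.swap : Y × X → X × Y) Prod.swap) := by
  rintro a b ⟨u, hu⟩
  have hprod : M.mulVec (u ∘ Prod.swap) = productVec b a := by
    have := congrArg (fun f => f ∘ Prod.swap) hu
    simp only [Matrix.mulVecLin_apply] at this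
    rw [show (Prod.swap : Y × X → X × Y) = Equiv.prodComm Y X from rfl,
      Matrix.submatrix_mulVec_equiv] at this
    funext p
    simpa [productVec, mul_comm] using congrFun this p
  funext p
  have := congrFun (h b a ⟨_, hprod⟩) p.swap
  simpa [productVec, mul_comm] using this

theorem productFreeRange_bipartite {S : Finset (Fin 3)} {i : Fin 3}
    (hS : (∀ j, j ∈ S ↔ j = i) ∨ ∀ j, j ∉ S ↔ j = i) {M : Matrix Bits Bits ℂ}
    (hM : SupportedOn M complU) : ProductFreeRange (bipartite S M) := by
  rintro a b ⟨u, hu⟩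
  let e := Equiv.piEquivPiSubtypeProd (fun j => j ∈ S) (fun _ : Fin 3 => Fin 2)
  have hval : ∀ f, M.mulVec (u ∘ e) f =
      a (fun j => f j) * b (fun j => f j) := by
    intro f
    have := congrFun hu (e f)
    simp only [Matrix.mulVecLin_apply, bipartite, Matrix.reindex_apply] at this
    rw [Matrix.submatrix_mulVec_equiv] at this
    simpa [e, productVec, Equiv.piEquivPiSubtypeProd] using this
  have hmem : WithLp.toLp 2 (M.mulVec (u ∘ e)) ∈ complU :=
    hM ⟨WithLp.toLp 2 (u ∘ e), by simp⟩
  -- Bit `i` is the whole label of one factor, so the exchange merely permutes the values of that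
  -- factor in the product.
  have hzero := eq_zero_of_mem_complU_of_exchange hmem i fun f g => by
    simp only [hval]
    rcases hS with hS | hS
    · have hin : ∀ f g : Bits, (fun j : {j // j ∈ S} => Function.update f i (g i) j) =
          fun j => g j.1 := by
        intro f g
        funext ⟨j, hj⟩
        obtain rfl := (hS j).1 hj
        simp
      have hout : ∀ f g : Bits, (fun j : {j // j ∉ S} => Function.update f i (g i) j) =
          fun j => f j.1 := by
        intro f g
        funext ⟨j, hj⟩
        simp [Function.update_of_ne fun h => hj ((hS j).2 h)]
      rw [hin, hin, hout, hout]
      ring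
    · have hin : ∀ f g : Bits, (fun j : {j // j ∈ S} => Function.update f i (g i) j) =
          fun j => f j.1 := by
        intro f g
        funext ⟨j, hj⟩
        simp [Function.update_of_ne fun h => (hS j).2 h hj]
      have hout : ∀ f g : Bits, (fun j : {j // j ∉ S} => Function.update f i (g i) j) =
          fun j => g j.1 := by
        intro f g
        funext ⟨j, hj⟩
        obtain rfl := (hS j).1 hj
        simp
      rw [hin, hin, hout, hout]
      ring
  funext p
  have := hval (e.symm p)
  rw [show M.mulVec (u ∘ e) = 0 from congrArg WithLp.ofLp hzero] at this
  have hp : e (e.symm p) = p := e.apply_symm_apply p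
  have h1 : (fun j : {j // j ∈ S} => e.symm p j) = p.1 := congrArg Prod.fst hp
  have h2 : (fun j : {j // j ∉ S} => e.symm p j) = p.2 := congrArg Prod.snd hp
  rw [h1, h2] at this
  exact this.symm

theorem exists_two_labels {p : Fin 3 → Prop} {i : Fin 3} (hp : ∀ j, p j ↔ j = i) :
    ∃ x₀ x₁ : {j // p j} → Fin 2, x₀ ≠ x₁ ∧ ∀ x, x = x₀ ∨ x = x₁ := by
  refine ⟨fun _ => 0, fun _ => 1, fun h => ?_, fun x => ?_⟩
  · exact absurd (congrFun h ⟨i, (hp i).2 rfl⟩) (by decide)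
  · have hx : ∀ j, x j = x ⟨i, (hp i).2 rfl⟩ := fun ⟨j, hj⟩ => by
      obtain rfl := (hp j).1 hj
      rfl
    have h2 : ∀ c : Fin 2, c = 0 ∨ c = 1 := by decide
    rcases h2 (x ⟨i, (hp i).2 rfl⟩) with h | h
    · exact Or.inl (funext fun j => (hx j).trans h)
    · exact Or.inr (funext fun j => (hx j).trans h)

theorem exists_party_of_proper {S : Finset (Fin 3)} (hne : S.Nonempty)
    (hproper : S ≠ Finset.univ) :
    ∃ i, (∀ j, j ∈ S ↔ j = i) ∨ ∀ j, j ∉ S ↔ j = i := by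
  revert S
  decide

/-- States and projectors enter only as nonzero positive operators. The marginal of larger rank
found here is the one on the two-qubit side. -/
theorem distillable_and_rank_lt_of_supportedOn {S : Finset (Fin 3)} (hne : S.Nonempty)
    (hproper : S ≠ Finset.univ) {M : Matrix Bits Bits ℂ} (hM : M.PosSemidef) (h0 : M ≠ 0)
    (hsupp : SupportedOn M complU) :
    OneCopyDistillable (bipartite S M) ∧
      M.rank < max (marginalFst (bipartite S M)).rank (marginalSnd (bipartite S M)).rank := by
  obtain ⟨i, hS⟩ := exists_party_of_proper hne hproper
  have hfree := productFreeRange_bipartite hS hsupp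
  have hpos : (bipartite S M).PosSemidef := hM.submatrix _
  have hB0 : bipartite S M ≠ 0 := fun h =>
    h0 ((Matrix.reindex _ _).injective h)
  have hrank : (bipartite S M).rank = M.rank := Matrix.rank_reindex _ _ M
  rw [← hrank]
  rcases hS with hS | hS
  · obtain ⟨x₀, x₁, hx, hX⟩ := exists_two_labels hS
    exact ⟨oneCopyDistillable_of_productFreeRange hx hX hpos hB0 hfree,
      lt_max_of_lt_right (rank_lt_rank_marginalSnd hx hX hpos hB0 hfree)⟩
  · obtain ⟨x₀, x₁, hx, hX⟩ := exists_two_labels hS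
    have hpos' := hpos.submatrix
      (Prod.swap : ({j // j ∉ S} → Fin 2) × ({j // j ∈ S} → Fin 2) → _)
    have hB0' : (bipartite S M).submatrix
        (Prod.swap : ({j // j ∉ S} → Fin 2) × ({j // j ∈ S} → Fin 2) → _) Prod.swap ≠ 0 := by
      intro h
      apply hB0
      ext p q
      exact congrFun (congrFun h p.swap) q.swap
    refine ⟨(oneCopyDistillable_of_productFreeRange hx hX hpos' hB0' hfree.swap).of_swap,
      lt_max_of_lt_left ?_⟩
    have := rank_lt_rank_marginalSnd hx hX hpos' hB0' hfree.swap
    rwa [show (Prod.swap : ({j // j ∉ S} → Fin 2) × ({j // j ∈ S} → Fin 2) → _) =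
      Equiv.prodComm _ _ from rfl, Matrix.rank_submatrix] at this

theorem proposition2 (S : Finset (Fin 3)) (hne : S.Nonempty) (hproper : S ≠ Finset.univ) :
    (∀ ρ : Matrix Bits Bits ℂ, IsState ρ → SupportedOn ρ complU →
      OneCopyDistillable (bipartite S ρ)) ∧
    (∀ P : Matrix Bits Bits ℂ, IsStarProjection P → P ≠ 0 → SupportedOn P complU →
      P.rank < max (marginalFst (bipartite S P)).rank (marginalSnd (bipartite S P)).rank) := by
  refine ⟨fun ρ hρ hsupp => ?_, fun P hP h0 hsupp => ?_⟩
  · have h0 : ρ ≠ 0 := by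
      rintro rfl
      simpa using hρ.2
    exact (distillable_and_rank_lt_of_supportedOn hne hproper hρ.1 h0 hsupp).1
  -- A projector equals `Pᴴ * P`.
  · have hpos : P.PosSemidef := by
      have := Matrix.posSemidef_conjTranspose_mul_self P
      rwa [show P.conjTranspose = P from hP.isSelfAdjoint, hP.isIdempotentElem.eq] at this
    exact (distillable_and_rank_lt_of_supportedOn hne hproper hpos h0 hsupp).2
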